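/- Let $S$ be a commutative $*$-semigroup with zero, i.e. an additively written commutative monoid with an involution satisfying $(s+t)^*=s^*+t^*$ and $s^{**}=s$. A character of $S$ is a nonzero map $\sigma:S\to\mathbb{C}$ with $\sigma(s+t)=\sigma(s)\sigma(t)$ and $\sigma(s^*)=\overline{\sigma(s)}$; $S^*$ is the set of characters, with the least $\sigma$-algebra making all evaluations $\hat s:\sigma\mapsto\sigma(s)$ measurable. Write $s\sim t$ if $\sigma(s)=\sigma(t)$ for all $\sigma\in S^*$; let $S/{\sim}$ be the quotient $*$-semigroup and $[s]$ the class of $s$. A function $\phi:S\to\mathbb{C}$ is positive definite ($\phi\in\mathfrak{P}(S)$) if $\sum_{i,j}\xi_i\overline{\xi_j}\,\phi(s_j^*+s_i)\ge 0$ for all finite families $s_i\in S$, $\xi_i\in\mathbb{C}$. It is a moment function ($\phi\in\mathfrak{M}(S)$) if $\phi(s)=\int_{S^*}\sigma(s)\,d\mu(\sigma)$ for all $s\in S$, for some positive measure $\mu$ on $S^*$ for which all $\hat s$ are square-integrable; then $\phi\in\mathfrak{P}(S)$. For $\phi\in\mathfrak{P}(S)$ let $\mathcal{H}^\phi\subseteq\mathbb{C}^S$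 be the reproducing kernel Hilbert space with kernel $K(s,t)=\phi(t^*+s)$, put $K_s=K(\cdot,s)$, and for $u\in S$ let $u_\phi$ be the closure of the (well-defined, closable) operator $\sum_j\xi_jK_{s_j}\mapsto\sum_j\xi_jK_{s_j+u}$ on the linear span of $\{K_s:s\in S\}$. Let $u\in S$ satisfy $[2u]=0$ and $[u]=[u^*]$. Then the following conditions are equivalent: (i) the set $\{[s]\in S/{\sim}:[u+s]\ne[s]\}$ is finite; (ii) $\sigma(u)=-1$ for only finitely many $\sigma\in S^*$; (iii) $\dim\ker(u_\phi+I)<\infty$ for all $\phi\in\mathfrak{M}(S)$; (iv) $\dim\ker(u_\phi+I)<\infty$ for all $\phi\in\mathfrak{P}(S)$. Moreover, if (i) holds, then for every $\phi\in\mathfrak{P}(S)$ the dimension of $\ker(u_\phi+I)$ is at most half the number of elements of the set in (i). Consequently, for an arbitrary $u\in S$ the following are equivalent: $u_\phi$ is a fundamental symmetry of a Pontryagin space (that is, $u_\phi=u_\phi^*$, $u_\phi^2=I$ and $\dim\ker(u_\phi+I)<\infty$) for every $\phi\in\mathfrak{P}(S)$; $u_\phi$ is such a symmetry for every $\phi\in\mathfrak{M}(S)$;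 $[2u]=0$, $[u]=[u^*]$ and the set in (i) is finite. -/

import Mathlib

open MeasureTheory
open scoped ComplexConjugate ComplexOrder

noncomputable section

namespace StarSemigroup

/-! A commutative `*`-semigroup with zero is a type `S` with `[AddCommMonoid S]` and
`[StarAddMonoid S]`: `star (s + t) = star s + star t` and `star (star s) = s`. -/

/-- A character: a nonzero `*`-homomorphism from `S` to `(ℂ, ·, conj)`. -/
structure Character (S : Type*) [AddCommMonoid S] [StarAddMonoid S] where
  toFun : S → ℂ
  map_add' : ∀ s t, toFun (s + t) = toFun s * toFun t
  map_star' : ∀ s, toFun (star s) = conj (toFun s)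
  exists_ne_zero' : ∃ s, toFun s ≠ 0

/-- A function `φ : S → ℂ` is positive definite if all the sums
`∑ i j, ξ i * conj (ξ j) * φ (star (s j) + s i)` are real and nonnegative. -/
def IsPositiveDefinite {S : Type*} [AddCommMonoid S] [StarAddMonoid S] (φ : S → ℂ) : Prop :=
  ∀ (N : ℕ) (s : Fin N → S) (ξ : Fin N → ℂ),
    0 ≤ ∑ i, ∑ j, ξ i * conj (ξ j) * φ (star (s j) + s i)

/-- The set of all positive definite functions on `S`. -/
structure PosDefFunction (S : Type*) [AddCommMonoid S] [StarAddMonoid S] where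
  toFun : S → ℂ
  isPositiveDefinite : IsPositiveDefinite toFun

variable {S : Type*} [AddCommMonoid S] [StarAddMonoid S]

/-! ### Characters and the greatest `*`-separative image -/

instance : FunLike (Character S) S ℂ where
  coe := Character.toFun
  coe_injective σ τ h := by
    cases σ
    cases τ
    congr

theorem Character.map_add (σ : Character S) (s t : S) : σ (s + t) = σ s * σ t := σ.map_add' s t

theorem Character.map_star (σ : Character S) (s : S) : σ (star s) = conj (σ s) := σ.map_star' s

/-- The congruence `s ∼ t` iff `σ s = σ t` for all characters `σ`. -/
def sepCon (S : Type*) [AddCommMonoid S] [StarAddMonoid S] : AddCon S where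
  r s t := ∀ σ : Character S, σ s = σ t
  iseqv := ⟨fun _ _ => rfl, fun h σ => (h σ).symm, fun h k σ => (h σ).trans (k σ)⟩
  add' h k σ := by rw [Character.map_add, Character.map_add, h σ, k σ]

/-- The greatest `*`-homomorphic `*`-separative image `S/∼` of `S`, with the quotient addition. -/
abbrev SepQuotient (S : Type*) [AddCommMonoid S] [StarAddMonoid S] : Type _ :=
  (sepCon S).Quotient

/-- The class `[s]` of `s` in `S/∼`. -/
def cls (s : S) : SepQuotient S := (s : (sepCon S).Quotient)

/-- The involution of `S/∼`, for which the quotient mapping is a `*`-homomorphism. -/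
instance : StarAddMonoid (SepQuotient S) where
  star := Quotient.map' star fun s t (h : ∀ σ : Character S, σ s = σ t) σ => by
    rw [Character.map_star, Character.map_star, h σ]
  star_involutive x := by
    induction x using AddCon.induction_on with
    | H s => exact congrArg cls (star_star s)
  star_add x y := by
    induction x using AddCon.induction_on with
    | H s =>
      induction y using AddCon.induction_on with
      | H t => exact congrArg cls (star_add s t)

theorem cls_add (s t : S) : cls (s + t) = cls s + cls t := rfl

theorem cls_star (s : S) : cls (star s) = star (cls s) := rfl

theorem cls_zero : cls (0 : S) = 0 := rfl

theorem cls_eq_cls_iff (s t : S) : cls s = cls t ↔ ∀ σ : Character S, σ s = σ t :=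
  (sepCon S).eq

/-- The set `{[s] ∈ S/∼ : [u + s] ≠ [s]}`. -/
def movedClasses (u : S) : Set (SepQuotient S) :=
  {x | ∃ s : S, cls s = x ∧ cls (u + s) ≠ cls s}

/-! ### Moment functions -/

/-- The least σ-algebra on the set of characters for which all evaluations are measurable. -/
instance : MeasurableSpace (Character S) :=
  ⨆ s : S, MeasurableSpace.comap (fun σ : Character S => σ s) (borel ℂ)

/-- `φ` is a moment function if `φ s = ∫ σ s dμ(σ)` for a positive measure `μ` on the set of
characters such that all the evaluations `σ ↦ σ s` are square-integrable. -/
def IsMomentFunction (φ : S → ℂ) : Prop :=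
  ∃ μ : Measure (Character S),
    (∀ s : S, MemLp (fun σ : Character S => σ s) 2 μ) ∧
    ∀ s : S, φ s = ∫ σ, σ s ∂μ

theorem IsMomentFunction.isPositiveDefinite {φ : S → ℂ} (h : IsMomentFunction φ) :
    IsPositiveDefinite φ := by
  obtain ⟨μ, hμ, hφ⟩ := h
  intro N s ξ
  have hint : ∀ i j : Fin N,
      Integrable (fun σ : Character S => ξ i * conj (ξ j) * σ (star (s j) + s i)) μ := by
    intro i j
    have h1 : Integrable (fun σ : Character S => σ (star (s j)) * σ (s i)) μ :=
      (hμ (star (s j))).integrable_mul (hμ (s i))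
    simpa only [Character.map_add] using h1.const_mul (ξ i * conj (ξ j))
  have key : ∑ i, ∑ j, ξ i * conj (ξ j) * φ (star (s j) + s i)
      = ∫ σ : Character S, ((‖∑ i, ξ i * σ (s i)‖ ^ 2 : ℝ) : ℂ) ∂μ := by
    calc ∑ i, ∑ j, ξ i * conj (ξ j) * φ (star (s j) + s i)
        = ∑ i, ∑ j, ∫ σ : Character S, ξ i * conj (ξ j) * σ (star (s j) + s i) ∂μ := by
          simp only [hφ, integral_const_mul]
      _ = ∫ σ : Character S, ∑ i, ∑ j, ξ i * conj (ξ j) * σ (star (s j) + s i) ∂μ := by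
          rw [integral_finsetSum _ fun i _ => integrable_finsetSum _ fun j _ => hint i j]
          exact Finset.sum_congr rfl fun i _ => (integral_finsetSum _ fun j _ => hint i j).symm
      _ = _ := by
          congr 1
          funext σ
          rw [Complex.ofReal_pow, ← Complex.mul_conj', map_sum, Finset.sum_mul_sum]
          refine Finset.sum_congr rfl fun i _ => Finset.sum_congr rfl fun j _ => ?_
          rw [Character.map_add, Character.map_star, map_mul]
          ring
  rw [key, integral_complex_ofReal]
  exact Complex.zero_le_real.2 (integral_nonneg fun σ => by positivity)

/-! ### The reproducing kernel Hilbert space -/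

theorem IsPositiveDefinite.map_star {φ : S → ℂ} (h : IsPositiveDefinite φ) (s : S) :
    φ (star s) = conj (φ s) := by
  have im0 : ∀ z : ℂ, 0 ≤ z → z.im = 0 := fun z hz => (Complex.nonneg_iff.1 hz).2.symm
  have hs := im0 _ (h 1 ![s] ![1])
  have h0 := im0 _ (h 1 ![0] ![1])
  have h1 := im0 _ (h 2 ![0, s] ![1, 1])
  have h2 := im0 _ (h 2 ![0, s] ![1, Complex.I])
  simp [Fin.sum_univ_two] at hs h0 h1 h2
  apply Complex.ext
  · simp only [Complex.conj_re]; linarith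
  · simp only [Complex.conj_im]; linarith

namespace PosDefFunction

/-- The kernel `K(s, t) = φ (star t + s)`, as a matrix of operators on `ℂ`. -/
def kernel (φ : PosDefFunction S) : Matrix S S (ℂ →L[ℂ] ℂ) :=
  Matrix.of fun s t => φ.toFun (star t + s) • (1 : ℂ →L[ℂ] ℂ)

theorem posSemidef_kernel (φ : PosDefFunction S) : φ.kernel.PosSemidef := by
  have hiff : φ.kernel.PosSemidef ↔ φ.kernel.IsHermitian ∧ ∀ v : S →₀ ℂ,
      0 ≤ RCLike.re (v.sum fun x w => v.sum fun x' w' => inner ℂ (φ.kernel x' x w) w') :=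
    RKHS.posSemidef_tfae.out 0 2
  rw [hiff]
  refine ⟨?_, fun v => ?_⟩
  · ext s t
    have := φ.isPositiveDefinite.map_star (star s + t)
    rw [star_add, star_star, add_comm] at this
    simp [Matrix.conjTranspose_apply, kernel, this]
  · have := (Complex.nonneg_iff.1 (φ.isPositiveDefinite v.support.card
      (fun i => (v.support.equivFin.symm i : S))
      (fun i => conj (v (v.support.equivFin.symm i : S))))).1
    refine this.trans_eq ?_
    rw [← RCLike.re_eq_complex_re]
    congr 1
    have e : ∀ F : S → ℂ → ℂ, v.sum F = ∑ i : Fin v.support.card,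
        F (v.support.equivFin.symm i) (v (v.support.equivFin.symm i)) := by
      intro F
      rw [Finsupp.sum, ← Finset.sum_coe_sort,
        ← Equiv.sum_comp v.support.equivFin.symm (fun i => F i (v i))]
    rw [e]
    refine Finset.sum_congr rfl fun i _ => ?_
    rw [e]
    refine Finset.sum_congr rfl fun j _ => ?_
    have hstar := φ.isPositiveDefinite.map_star
      (star (v.support.equivFin.symm i : S) + v.support.equivFin.symm j)
    rw [star_add, star_star, add_comm] at hstar
    simp [kernel, hstar]
    ring

instance (φ : PosDefFunction S) : Fact φ.kernel.PosSemidef := ⟨φ.posSemidef_kernel⟩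

/-- The reproducing kernel Hilbert space `H^φ` of functions on `S` with kernel
`K(s, t) = φ (star t + s)`. -/
def Space (φ : PosDefFunction S) : Type _ := RKHS.OfKernel φ.kernel

variable (φ : PosDefFunction S)

instance : NormedAddCommGroup φ.Space := inferInstanceAs (NormedAddCommGroup (RKHS.OfKernel φ.kernel))

instance : InnerProductSpace ℂ φ.Space :=
  inferInstanceAs (InnerProductSpace ℂ (RKHS.OfKernel φ.kernel))

instance : CompleteSpace φ.Space := inferInstanceAs (CompleteSpace (RKHS.OfKernel φ.kernel))

instance : RKHS ℂ φ.Space S ℂ := inferInstanceAs (RKHS ℂ (RKHS.OfKernel φ.kernel) S ℂ)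

/-- The kernel function `K_s = K(·, s)`, as an element of `H^φ`. -/
def kerVec (s : S) : φ.Space := RKHS.kerFun φ.Space s 1

theorem kernel_space : RKHS.kernel φ.Space = φ.kernel :=
  RKHS.OfKernel.kernel_ofKernel (K := φ.kernel)

theorem kerVec_apply (s t : S) : φ.kerVec s t = φ.toFun (star s + t) := by
  rw [kerVec, RKHS.kerFun_apply, kernel_space]
  simp [kernel]

/-- The reproducing property. -/
theorem inner_kerVec (s : S) (f : φ.Space) : inner ℂ (φ.kerVec s) f = f s := by
  simp [kerVec]

/-! ### The shift operator -/

/-- The graph of `A(u, φ)`: the set of all pairs `(∑ ξ j • K_{s j}, ∑ ξ j • K_{s j + u})`. -/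
def preShiftGraph (u : S) : Submodule ℂ (φ.Space × φ.Space) :=
  Submodule.span ℂ (Set.range fun s => (φ.kerVec s, φ.kerVec (s + u)))

/-- The operator `A(u, φ)`, `∑ ξ j • K_{s j} ↦ ∑ ξ j • K_{s j + u}`, with domain the linear span
`D^φ` of the kernel functions. -/
def preShift (u : S) : φ.Space →ₗ.[ℂ] φ.Space := (φ.preShiftGraph u).toLinearPMap

/-- The operator `u_φ`: the closure of `A(u, φ)`. -/
def shift (u : S) : φ.Space →ₗ.[ℂ] φ.Space := (φ.preShift u).closure

theorem snd_apply_of_mem_closure (u : S) {p : φ.Space × φ.Space}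
    (hp : p ∈ (φ.preShiftGraph u).topologicalClosure) (t : S) : p.2 t = p.1 (t + star u) := by
  let C : Submodule ℂ (φ.Space × φ.Space) :=
    { carrier := {p | p.2 t = p.1 (t + star u)}
      add_mem' := fun {a b} ha hb => by
        simp only [Set.mem_ofPred_eq] at ha hb
        simp [ha, hb]
      zero_mem' := by simp
      smul_mem' := fun c a ha => by
        simp only [Set.mem_ofPred_eq] at ha
        simp [ha] }
  have hC : IsClosed (C : Set (φ.Space × φ.Space)) :=
    isClosed_eq ((RKHS.continuous_eval t).comp continuous_snd)
      ((RKHS.continuous_eval (t + star u)).comp continuous_fst)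
  refine Submodule.topologicalClosure_minimal _ (t := C) ?_ hC hp
  refine Submodule.span_le.2 ?_
  rintro _ ⟨s, rfl⟩
  change φ.kerVec (s + u) t = φ.kerVec s (t + star u)
  rw [kerVec_apply, kerVec_apply, star_add]
  congr 1
  abel

theorem snd_eq_zero_of_mem_closure (u : S) (p : φ.Space × φ.Space)
    (hp : p ∈ (φ.preShiftGraph u).topologicalClosure) (h0 : p.1 = 0) : p.2 = 0 := by
  refine RKHS.ext fun t => ?_
  rw [φ.snd_apply_of_mem_closure u hp t, h0]
  simp

/-- `A(u, φ)` is well defined. -/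
theorem graph_preShift (u : S) : (φ.preShift u).graph = φ.preShiftGraph u :=
  Submodule.toLinearPMap_graph_eq _ fun p hp h0 =>
    φ.snd_eq_zero_of_mem_closure u p (Submodule.le_topologicalClosure _ hp) h0

theorem domain_preShift (u : S) :
    (φ.preShift u).domain = Submodule.span ℂ (Set.range φ.kerVec) := by
  rw [preShift, Submodule.toLinearPMap_domain, preShiftGraph, Submodule.map_span, ← Set.range_comp]
  rfl

/-- `A(u, φ)` is closable. -/
theorem isClosable_preShift (u : S) : (φ.preShift u).IsClosable := by
  refine ⟨(φ.preShiftGraph u).topologicalClosure.toLinearPMap, ?_⟩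
  rw [graph_preShift, Submodule.toLinearPMap_graph_eq _ (φ.snd_eq_zero_of_mem_closure u)]

theorem graph_shift (u : S) : (φ.shift u).graph = (φ.preShiftGraph u).topologicalClosure := by
  rw [shift, ← (φ.isClosable_preShift u).graph_closure_eq_closure_graph, graph_preShift]

theorem dense_domain_shift (u : S) : Dense ((φ.shift u).domain : Set φ.Space) := by
  have h := RKHS.kerFun_dense φ.Space
  rw [← Submodule.dense_iff_topologicalClosure_eq_top] at h
  refine h.mono (SetLike.coe_subset_coe.2 ((Submodule.span_le.2 ?_).trans
    (LinearPMap.le_closure (φ.preShift u)).1))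
  rintro _ ⟨s, v, rfl⟩
  rw [domain_preShift]
  have : RKHS.kerFun φ.Space s v = v • φ.kerVec s := by
    rw [kerVec, ← map_smul, smul_eq_mul, mul_one]
  rw [this]
  exact Submodule.smul_mem _ _ (Submodule.subset_span ⟨s, rfl⟩)

end PosDefFunction

/-! ### Fundamental symmetries -/

/-- `ker (T + I)`: the set of all `f` in the domain of `T` with `T f = -f`. -/
def kerAddId {H : Type*} [NormedAddCommGroup H] [InnerProductSpace ℂ H] (T : H →ₗ.[ℂ] H) :
    Submodule ℂ H :=
  T.graph.comap (LinearMap.prod LinearMap.id (-LinearMap.id))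

/-- `T` is a fundamental symmetry of a Pontryagin space: `T = T*`, `T² = I` (with `T²` the
composition of the partially defined operators) and `ker (T + I)` has finite dimension. -/
structure IsPontryaginSymmetry {H : Type*} [NormedAddCommGroup H] [InnerProductSpace ℂ H]
    [CompleteSpace H] (T : H →ₗ.[ℂ] H) : Prop where
  adjoint_eq : T.adjoint = T
  sq_eq_id : ∀ x z : H, (∃ y, (x, y) ∈ T.graph ∧ (y, z) ∈ T.graph) ↔ z = x
  finite_ker : FiniteDimensional ℂ (kerAddId T)

end StarSemigroup

end

noncomputable section

namespace StarSemigroup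

variable {S : Type*} [AddCommMonoid S] [StarAddMonoid S]

namespace PosDefFunction

variable (φ : PosDefFunction S)

/-! The core is `PosDefFunction.kerVec_eq_of_forall_character_eq`: if no character separates `x`
from `y`, then `K_x = K_y` for every positive definite function. Characters extended by zero from
faces show that `x` and `y` generate the same `*`-invariant face. Unitary and positive characters of
that face then force relations between `x` and `y` in its Grothendieck group. A convexity argument
and cancellation laws in the Hilbert space turn these relations into `K_x = K_y`.

Hence, when `[2u] = 0` and `[u] = [u*]`, the operator `u_φ` is an everywhere defined, self-adjoint
isometric involution. Its `-1` eigenspace is the range of `I - u_φ`. If finitely many classes are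
moved, this range is spanned by the vectors `K_s - K_{s+u}` with `[s]` moved. Translation by `[u]`
pairs the moved classes without fixed points and negates these vectors, which gives the factor one
half.

Conversely, infinitely many characters with `σ u = -1` yield a pointwise bounded sequence of
distinct ones. A finite measure charging each of its terms has a moment function whose eigenspace is
infinite-dimensional. If there are only finitely many such characters, their odd powers show that
each has finite range, and their values determine a moved class. The final equivalence also tests
`u_φ` on the moment functions `φ = σ`, which recovers `[2u] = 0` and `[u] = [u*]`. -/

theorem inner_kerVec_kerVec (s t : S) :
    inner ℂ (φ.kerVec s) (φ.kerVec t) = φ.toFun (star t + s) := by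
  rw [inner_kerVec, kerVec_apply]

variable {φ}

/-! ### Cancellation laws for kernel vectors -/

theorem kerVec_eq_iff {s t : S} :
    φ.kerVec s = φ.kerVec t ↔ ∀ v, φ.toFun (s + v) = φ.toFun (t + v) := by
  have key : ∀ s v : S, φ.kerVec s (star v) = conj (φ.toFun (s + v)) := fun s v => by
    rw [kerVec_apply, ← φ.isPositiveDefinite.map_star, star_add]
  constructor
  · intro h v
    have := congrArg (fun f : φ.Space => conj (f (star v))) h
    simpa [key] using this
  · intro h
    refine RKHS.ext fun v => ?_
    rw [← star_star v, key, key, h]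

theorem kerVec_add_congr {s t : S} (h : φ.kerVec s = φ.kerVec t) (v : S) :
    φ.kerVec (s + v) = φ.kerVec (t + v) := by
  rw [kerVec_eq_iff] at h ⊢
  intro w
  rw [add_assoc, add_assoc, h]

/-- If two elements of the form `star a + a` have equal multiples up to translation, then the
corresponding kernel functions agree up to translation. -/
theorem kerVec_eq_of_nsmul_eq {a b c : S} {N : ℕ}
    (h : (N + 1) • (a + star a) + c = (N + 1) • (b + star b) + c) :
    φ.kerVec (a + star a + (N • b + c)) = φ.kerVec (b + star b + (N • b + c)) := by
  set p := a + star a with hp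
  set r := b + star b with hr
  set e : ℕ → S := fun i => i • a + (N - i) • b + c with he
  -- The second differences of `g` are squared norms, so `g` is convex. The hypothesis makes its
  -- first and last increments equal, so all second differences vanish.
  set g : ℕ → ℂ := fun k => φ.toFun (k • p + (N + 2 - k) • r + (c + star c)) with hg
  have hps : star p = p := by rw [hp, star_add, star_star, add_comm]
  have hrs : star r = r := by rw [hr, star_add, star_star, add_comm]
  have hee : ∀ i, star (e i) + e i = i • p + (N - i) • r + (c + star c) := by
    intro i
    simp only [he, hp, hr, star_add, star_nsmul, smul_add]
    abel
  have hnorm : ∀ i ∈ Finset.range (N + 1),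
      ((‖φ.kerVec (p + e i) - φ.kerVec (r + e i)‖ ^ 2 : ℝ) : ℂ)
        = (g (i + 2) - g (i + 1)) - (g (i + 1) - g i) := by
    intro i hi
    have hi' : i ≤ N := Nat.lt_succ_iff.1 (Finset.mem_range.1 hi)
    obtain ⟨j, rfl⟩ := Nat.exists_eq_add_of_le hi'
    have hn := inner_self_eq_norm_sq_to_K (𝕜 := ℂ) (φ.kerVec (p + e i) - φ.kerVec (r + e i))
    rw [Complex.ofReal_pow]
    refine hn.symm.trans ?_
    have e1 : star (p + e i) + (p + e i) = (i + 2) • p + j • r + (c + star c) := by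
      rw [star_add, hps, add_add_add_comm, hee, Nat.add_sub_cancel_left, add_smul, two_nsmul]
      abel
    have e2 : star (r + e i) + (p + e i) = (i + 1) • p + (j + 1) • r + (c + star c) := by
      rw [star_add, hrs, add_add_add_comm, hee, Nat.add_sub_cancel_left, add_smul, add_smul,
        one_nsmul, one_nsmul]
      abel
    have e3 : star (p + e i) + (r + e i) = (i + 1) • p + (j + 1) • r + (c + star c) := by
      rw [star_add, hps, add_add_add_comm, hee, Nat.add_sub_cancel_left, add_smul, add_smul,
        one_nsmul, one_nsmul]
      abel
    have e4 : star (r + e i) + (r + e i) = i • p + (j + 2) • r + (c + star c) := by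
      rw [star_add, hrs, add_add_add_comm, hee, Nat.add_sub_cancel_left, add_smul, two_nsmul]
      abel
    rw [inner_sub_left, inner_sub_right, inner_sub_right, inner_kerVec_kerVec,
      inner_kerVec_kerVec, inner_kerVec_kerVec, inner_kerVec_kerVec, e1, e2, e3, e4]
    simp only [hg]
    rw [show i + j + 2 - (i + 2) = j by omega, show i + j + 2 - (i + 1) = j + 1 by omega,
      show i + j + 2 - i = j + 2 by omega]
  have hsum : ∑ i ∈ Finset.range (N + 1),
      ‖φ.kerVec (p + e i) - φ.kerVec (r + e i)‖ ^ 2 = 0 := by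
    apply Complex.ofReal_injective
    rw [Complex.ofReal_sum, Finset.sum_congr rfl hnorm,
      Finset.sum_range_sub (fun i => g (i + 1) - g i)]
    have h1 : g (N + 2) = g 1 := by
      simp only [hg]
      congr 1
      calc (N + 2) • p + (N + 2 - (N + 2)) • r + (c + star c)
          = ((N + 1) • p + c) + (p + star c) := by
            rw [Nat.sub_self, zero_nsmul, succ_nsmul p (N + 1)]; abel
        _ = 1 • p + (N + 2 - 1) • r + (c + star c) := by
            rw [h, one_nsmul, show N + 2 - 1 = N + 1 by omega]; abel
    have h2 : g (N + 1) = g 0 := by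
      simp only [hg]
      congr 1
      calc (N + 1) • p + (N + 2 - (N + 1)) • r + (c + star c)
          = ((N + 1) • p + c) + (r + star c) := by
            rw [show N + 2 - (N + 1) = 1 by omega, one_nsmul]; abel
        _ = 0 • p + (N + 2 - 0) • r + (c + star c) := by
            rw [h, zero_nsmul, Nat.sub_zero, succ_nsmul r (N + 1)]; abel
    simp [h1, h2]
  -- Only the term `i = 0` is needed, where `e 0 = N • b + c`.
  have h0 := (Finset.sum_eq_zero_iff_of_nonneg fun i _ => by positivity).1 hsum 0 (by simp)
  have h0' := sub_eq_zero.1 (norm_eq_zero.1 (pow_eq_zero_iff two_ne_zero |>.1 h0))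
  simpa [he] using h0'

/-- Moving `star s` across the inner product shows that the difference of the two vectors is
orthogonal to every `K_{z+s}`, hence to itself. -/
theorem kerVec_eq_of_star_add_self {x y s : S}
    (h : φ.kerVec (x + (s + star s)) = φ.kerVec (y + (s + star s))) :
    φ.kerVec (x + s) = φ.kerVec (y + s) := by
  have h0 : ∀ z : S, inner ℂ (φ.kerVec (z + s)) (φ.kerVec (x + s) - φ.kerVec (y + s)) = 0 := by
    intro z
    have : inner ℂ (φ.kerVec z)
        (φ.kerVec (x + (s + star s)) - φ.kerVec (y + (s + star s))) = 0 := by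
      rw [h, sub_self, inner_zero_right]
    rw [inner_sub_right, inner_kerVec_kerVec, inner_kerVec_kerVec] at this ⊢
    rw [← this]
    congr 2 <;> · simp only [star_add, star_star]; abel
  have h1 : inner ℂ (φ.kerVec (x + s) - φ.kerVec (y + s))
      (φ.kerVec (x + s) - φ.kerVec (y + s)) = 0 := by
    rw [inner_sub_left, h0, h0, sub_zero]
  exact sub_eq_zero.1 (inner_self_eq_zero.1 h1)

theorem kerVec_eq_of_two_pow {x y s : S} (k : ℕ)
    (h : φ.kerVec (x + 2 ^ k • (s + star s)) = φ.kerVec (y + 2 ^ k • (s + star s))) :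
    φ.kerVec (x + s) = φ.kerVec (y + s) := by
  induction k with
  | zero => exact kerVec_eq_of_star_add_self (by simpa using h)
  | succ k ih =>
    -- The element `2 ^ k • (s + star s)` is hermitian, so adding its star doubles it.
    refine ih (kerVec_eq_of_star_add_self ?_)
    rw [star_nsmul, star_add, star_star, add_comm (star s) s, ← two_nsmul, ← mul_smul,
      ← pow_succ']
    exact h

theorem kerVec_eq_of_add_eq {x y s d w : S} {m : ℕ} (hd : d + w = m • (s + star s))
    (h : φ.kerVec (x + d) = φ.kerVec (y + d)) : φ.kerVec (x + s) = φ.kerVec (y + s) := by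
  refine kerVec_eq_of_two_pow m ?_
  -- Since `m ≤ 2 ^ m`, the element `d` can be padded up to `2 ^ m • (s + star s)`.
  obtain ⟨j, hj⟩ := Nat.exists_eq_add_of_le (Nat.lt_two_pow_self (n := m)).le
  have := kerVec_add_congr h (w + j • (s + star s))
  rw [hj, add_smul, ← hd]
  convert this using 2 <;> abel

/-- The summand `d` is first traded for `star x` and for `star y`. The two resulting equalities say
that `K_x - K_y` is orthogonal to both `K_x` and `K_y`. -/
theorem kerVec_eq_of_mem_faces {x y d w w' : S} {m m' : ℕ}
    (hx : d + w = m • (x + star x)) (hy : d + w' = m' • (y + star y))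
    (h : φ.kerVec (x + d) = φ.kerVec (y + d)) : φ.kerVec x = φ.kerVec y := by
  have swap : ∀ z : S, z + star z = star z + star (star z) := fun z => by
    rw [star_star, add_comm]
  have hx1 := kerVec_eq_of_add_eq (s := star x) (by rw [← swap]; exact hx) h
  have hy1 := kerVec_eq_of_add_eq (s := star y) (by rw [← swap]; exact hy) h
  have key : ∀ s : S, φ.kerVec (x + star s) = φ.kerVec (y + star s) →
      inner ℂ (φ.kerVec s) (φ.kerVec x - φ.kerVec y) = 0 := by
    intro s hs
    have : inner ℂ (φ.kerVec 0) (φ.kerVec (x + star s) - φ.kerVec (y + star s)) = 0 := by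
      rw [hs, sub_self, inner_zero_right]
    rw [inner_sub_right, inner_kerVec_kerVec, inner_kerVec_kerVec] at this ⊢
    simpa using this
  have h1 : inner ℂ (φ.kerVec x - φ.kerVec y) (φ.kerVec x - φ.kerVec y) = 0 := by
    rw [inner_sub_left, key x hx1, key y hy1, sub_zero]
  exact sub_eq_zero.1 (inner_self_eq_zero.1 h1)

end PosDefFunction

theorem Character.map_zero (σ : Character S) : σ 0 = 1 := by
  obtain ⟨s, hs⟩ := σ.exists_ne_zero'
  have h := σ.map_add' s 0
  rw [add_zero] at h
  exact (mul_eq_left₀ hs).1 h.symm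

/-! ### Characters supported on faces -/

/-- The extension by zero of a character of a `*`-invariant face. -/
def Character.ofFace (F : AddSubmonoid S) (hstar : ∀ s ∈ F, star s ∈ F)
    (hface : ∀ s t, s + t ∈ F → s ∈ F) (f : F → ℂ) (h0 : f 0 ≠ 0)
    (hadd : ∀ s t, f (s + t) = f s * f t)
    (hconj : ∀ s : F, f ⟨star s, hstar s s.2⟩ = conj (f s)) : Character S where
  toFun s := open Classical in if h : s ∈ F then f ⟨s, h⟩ else 0
  map_add' s t := by
    by_cases hs : s ∈ F
    · by_cases ht : t ∈ F
      · rw [dif_pos hs, dif_pos ht, dif_pos (F.add_mem hs ht), ← hadd]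
        rfl
      · rw [dif_neg ht, mul_zero, dif_neg fun h => ht (hface t s (by rwa [add_comm]))]
    · rw [dif_neg hs, zero_mul, dif_neg fun h => hs (hface s t h)]
  map_star' s := by
    by_cases hs : s ∈ F
    · rw [dif_pos hs, dif_pos (hstar s hs)]
      exact hconj ⟨s, hs⟩
    · rw [dif_neg hs, _root_.map_zero,
        dif_neg fun h => hs (by simpa using hstar _ h)]
  exists_ne_zero' := ⟨0, by rw [dif_pos F.zero_mem]; exact h0⟩

theorem Character.ofFace_apply {F : AddSubmonoid S} {hstar : ∀ s ∈ F, star s ∈ F}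
    {hface : ∀ s t, s + t ∈ F → s ∈ F} {f : F → ℂ} {h0 : f 0 ≠ 0}
    {hadd : ∀ s t, f (s + t) = f s * f t}
    {hconj : ∀ s : F, f ⟨star s, hstar s s.2⟩ = conj (f s)} (s : F) :
    Character.ofFace F hstar hface f h0 hadd hconj s = f s :=
  dif_pos s.2

theorem Character.ofFace_apply_of_notMem {F : AddSubmonoid S} {hstar : ∀ s ∈ F, star s ∈ F}
    {hface : ∀ s t, s + t ∈ F → s ∈ F} {f : F → ℂ} {h0 : f 0 ≠ 0}
    {hadd : ∀ s t, f (s + t) = f s * f t}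
    {hconj : ∀ s : F, f ⟨star s, hstar s s.2⟩ = conj (f s)} {s : S} (hs : s ∉ F) :
    Character.ofFace F hstar hface f h0 hadd hconj s = 0 :=
  dif_neg hs

/-- The least `*`-invariant face containing `x`. -/
def face (x : S) : AddSubmonoid S where
  carrier := {z | ∃ (w : S) (m : ℕ), z + w = m • (x + star x)}
  zero_mem' := ⟨0, 0, by simp⟩
  add_mem' := by
    rintro a b ⟨w, m, h⟩ ⟨w', m', h'⟩
    exact ⟨w + w', m + m', by rw [add_add_add_comm, h, h', add_smul]⟩

theorem star_mem_face {x : S} : ∀ s ∈ face x, star s ∈ face x := by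
  rintro s ⟨w, m, h⟩
  refine ⟨star w, m, ?_⟩
  rw [← star_add, h, star_nsmul, star_add, star_star, add_comm (star x)]

theorem mem_face_of_add {x : S} : ∀ s t, s + t ∈ face x → s ∈ face x := by
  rintro s t ⟨w, m, h⟩
  exact ⟨t + w, m, by rw [← add_assoc, h]⟩

theorem self_mem_face (x : S) : x ∈ face x := ⟨star x, 1, by rw [one_nsmul]⟩

theorem face_le_of_mem {x y : S} (h : x ∈ face y) : face x ≤ face y := by
  rintro z ⟨w, m, hz⟩
  refine mem_face_of_add z w ?_
  rw [hz]
  exact AddSubmonoid.nsmul_mem _ (add_mem h (star_mem_face x h)) m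

/-- The indicator function of a `*`-invariant face is a character. -/
theorem mem_face_of_forall_character_eq {x y : S} (h : ∀ σ : Character S, σ x = σ y) :
    y ∈ face x := by
  by_contra hy
  let σ := Character.ofFace (face x) star_mem_face mem_face_of_add (fun _ => 1) one_ne_zero
    (by simp) (by simp)
  have h1 : σ x = 1 := Character.ofFace_apply (⟨x, self_mem_face x⟩ : face x)
  have h2 : σ y = 0 := Character.ofFace_apply_of_notMem hy
  exact one_ne_zero (h1.symm.trans ((h σ).trans h2))

/-! ### Separating homomorphisms of abelian groups -/

/-- The embedding of `ℚ / ℤ` into the unit circle. -/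
def ratCircle : AddCircle (1 : ℚ) →+ Additive Circle :=
  QuotientAddGroup.lift _
    ((Circle.expHom : ℝ →+ Additive Circle).comp
      ((AddMonoidHom.mulLeft (2 * Real.pi)).comp (Rat.castHom ℝ).toAddMonoidHom)) <| by
    intro q hq
    obtain ⟨n, rfl⟩ := AddSubgroup.mem_zmultiples_iff.1 hq
    have : Circle.exp (2 * Real.pi * n) = 1 := by
      rw [Circle.exp_eq_one]
      exact ⟨n, by ring⟩
    simpa using this

theorem ratCircle_injective : Function.Injective ratCircle := by
  rw [injective_iff_map_eq_zero]
  intro a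
  induction a using QuotientAddGroup.induction_on with
  | H q =>
    intro h
    have h1 : Circle.exp (2 * Real.pi * (q : ℝ)) = 1 := h
    obtain ⟨n, hn⟩ := Circle.exp_eq_one.1 h1
    have h2 : (q : ℝ) = n := by
      have := Real.pi_pos
      field_simp at hn
      linarith
    have h3 : q = n := by exact_mod_cast h2
    rw [QuotientAddGroup.eq_zero_iff, AddSubgroup.mem_zmultiples_iff]
    exact ⟨n, by simp [h3]⟩

/-- Homomorphisms into `ℚ / ℤ` separate the points of `G ⧸ N`, and `ℚ / ℤ` embeds in the circle. -/
theorem exists_circle_hom_ne_zero {G : Type*} [AddCommGroup G] {N : AddSubgroup G} {g : G}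
    (hg : g ∉ N) : ∃ α : G →+ Additive Circle, (∀ x ∈ N, α x = 0) ∧ α g ≠ 0 := by
  have hne : (g : G ⧸ N) ≠ 0 := fun h => hg ((QuotientAddGroup.eq_zero_iff g).1 h)
  obtain ⟨c, hc⟩ := CharacterModule.exists_character_apply_ne_zero_of_ne_zero hne
  refine ⟨(ratCircle.comp (c : G ⧸ N →+ AddCircle (1 : ℚ))).comp (QuotientAddGroup.mk' N),
    fun x hx => ?_, fun h => hc ?_⟩
  · have hx0 : (x : G ⧸ N) = 0 := (QuotientAddGroup.eq_zero_iff x).2 hx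
    change ratCircle (c (x : G ⧸ N)) = 0
    rw [hx0, map_zero, map_zero]
  · exact ratCircle_injective (h.trans (map_zero _).symm)

/-- Since `ℝ` is divisible, hence injective, the map `n • g ↦ n` extends from the infinite cyclic
subgroup generated by `g`. -/
theorem exists_real_hom_ne_zero {G : Type*} [AddCommGroup G] {g : G}
    (hg : ∀ n : ℕ, 0 < n → n • g ≠ 0) : ∃ α : G →+ ℝ, α g ≠ 0 := by
  have hinj : Function.Injective (zmultiplesHom G g) :=
    injective_zsmul_iff_not_isOfFinAddOrder.2 fun h => by
      obtain ⟨n, hn, h0⟩ := isOfFinAddOrder_iff_nsmul_eq_zero.1 h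
      exact hg n hn h0
  obtain ⟨β, hβ⟩ := (Module.Baer.of_divisible ℝ).extension_property_addMonoidHom
    (zmultiplesHom G g) hinj (zmultiplesHom ℝ 1)
  refine ⟨β, ?_⟩
  have := DFunLike.congr_fun hβ 1
  simp at this
  simp [this]

/-! ### Points that are not separated by characters -/

section GrothendieckGroup

open Algebra

variable {x : S}

/-- The homomorphism `s ↦ s + star s` on the Grothendieck group of a face. -/
def normHom (x : S) : GrothendieckAddGroup (face x) →+ GrothendieckAddGroup (face x) :=
  GrothendieckAddGroup.lift
    { toFun := fun s => GrothendieckAddGroup.of s +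
        GrothendieckAddGroup.of ⟨star (s : S), star_mem_face _ s.2⟩
      map_zero' := by
        have : (⟨star ((0 : face x) : S), star_mem_face _ (0 : face x).2⟩ : face x) = 0 :=
          Subtype.ext (star_zero S)
        rw [this, map_zero, add_zero]
      map_add' := fun s t => by
        have : (⟨star ((s + t : face x) : S), star_mem_face _ (s + t).2⟩ : face x)
            = ⟨star (s : S), star_mem_face _ s.2⟩ + ⟨star (t : S), star_mem_face _ t.2⟩ :=
          Subtype.ext (star_add (s : S) t)
        rw [this, map_add, map_add, add_add_add_comm] }

theorem normHom_of (s : face x) :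
    normHom x (GrothendieckAddGroup.of s) = GrothendieckAddGroup.of s +
      GrothendieckAddGroup.of ⟨star (s : S), star_mem_face _ s.2⟩ :=
  DFunLike.congr_fun (GrothendieckAddGroup.lift.symm_apply_apply _) s

theorem exists_of_sub_of (g : GrothendieckAddGroup (face x)) :
    ∃ a b : face x, g = GrothendieckAddGroup.of a - GrothendieckAddGroup.of b := by
  obtain ⟨⟨a, b⟩, h⟩ := (AddLocalization.addMonoidOf (⊤ : AddSubmonoid (face x))).surj g
  exact ⟨a, b, eq_sub_of_add_eq h⟩

theorem of_eq_of_iff {a b : face x} :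
    GrothendieckAddGroup.of a = GrothendieckAddGroup.of b ↔ ∃ c : face x, a + c = b + c := by
  rw [show GrothendieckAddGroup.of a = GrothendieckAddGroup.of b ↔ _ from
    (AddLocalization.addMonoidOf (⊤ : AddSubmonoid (face x))).eq_iff_exists]
  constructor
  · rintro ⟨c, h⟩
    exact ⟨c, by rw [add_comm a, add_comm b]; exact h⟩
  · rintro ⟨c, h⟩
    exact ⟨⟨c, trivial⟩, by rw [add_comm a, add_comm b] at h; exact h⟩

/-- A circle-valued homomorphism respects the involution exactly when it kills all `s + star s`. If
the difference were outside the range, such a homomorphism would separate `x` from `y`. -/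
theorem of_sub_of_mem_range_normHom {y : S} (h : ∀ σ : Character S, σ x = σ y)
    (hy : y ∈ face x) :
    GrothendieckAddGroup.of ⟨x, self_mem_face x⟩ - GrothendieckAddGroup.of ⟨y, hy⟩
      ∈ (normHom x).range := by
  by_contra hg
  obtain ⟨α, hα, hne⟩ := exists_circle_hom_ne_zero hg
  let f : face x → ℂ := fun s => ((α (GrothendieckAddGroup.of s)).toMul : Circle)
  let σ := Character.ofFace (face x) star_mem_face mem_face_of_add f
    (by simp [f]) (by simp [f]) <| by
      intro s
      have h1 := hα _ ⟨GrothendieckAddGroup.of s, rfl⟩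
      rw [normHom_of, map_add] at h1
      have h2 := eq_neg_of_add_eq_zero_right h1
      simp only [f]
      rw [h2, toMul_neg, Circle.coe_inv_eq_conj]
  have h1 : f ⟨x, self_mem_face x⟩ = f ⟨y, hy⟩ := by
    rw [← Character.ofFace_apply (f := f), ← Character.ofFace_apply (f := f)]
    exact h σ
  apply hne
  rw [map_sub, sub_eq_zero]
  exact Circle.ext h1

/-- Otherwise some real homomorphism `α` is nonzero at this element, and the positive character `exp
∘ α ∘ normHom` separates `x` from `y`. -/
theorem exists_nsmul_normHom_eq_zero {y : S} (h : ∀ σ : Character S, σ x = σ y)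
    (hy : y ∈ face x) :
    ∃ n : ℕ, 0 < n ∧ n • normHom x (GrothendieckAddGroup.of ⟨x, self_mem_face x⟩ -
      GrothendieckAddGroup.of ⟨y, hy⟩) = 0 := by
  by_contra! hg
  obtain ⟨α, hne⟩ := exists_real_hom_ne_zero hg
  let f : face x → ℂ := fun s => (Real.exp (α (normHom x (GrothendieckAddGroup.of s))) : ℝ)
  let σ := Character.ofFace (face x) star_mem_face mem_face_of_add f
    (by simp [f]) (by simp [f, Complex.exp_add]) <| by
      intro s
      simp only [f]
      rw [Complex.conj_ofReal, normHom_of, normHom_of]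
      simp only [star_star]
      rw [add_comm]
  have h1 : f ⟨x, self_mem_face x⟩ = f ⟨y, hy⟩ := by
    rw [← Character.ofFace_apply (f := f), ← Character.ofFace_apply (f := f)]
    exact h σ
  apply hne
  rw [map_sub, map_sub, sub_eq_zero]
  exact Real.exp_injective (Complex.ofReal_injective h1)

end GrothendieckGroup

open Algebra in
/-- Positive definite functions do not separate points that characters do not separate. -/
theorem PosDefFunction.kerVec_eq_of_forall_character_eq (φ : PosDefFunction S) {x y : S}
    (h : ∀ σ : Character S, σ x = σ y) : φ.kerVec x = φ.kerVec y := by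
  have hy := mem_face_of_forall_character_eq h
  have hxy := face_le_of_mem (mem_face_of_forall_character_eq fun σ => (h σ).symm)
  obtain ⟨g, hg⟩ := of_sub_of_mem_range_normHom h hy
  obtain ⟨n, hn, hn0⟩ := exists_nsmul_normHom_eq_zero h hy
  obtain ⟨a, b, rfl⟩ := exists_of_sub_of g
  rw [← hg] at hn0
  let st : face x → face x := fun s => ⟨star (s : S), star_mem_face _ s.2⟩
  have hst : ∀ s, st (st s) = s := fun s => Subtype.ext (star_star (s : S))
  have hν : ∀ s : face x, normHom x (GrothendieckAddGroup.of s) =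
    GrothendieckAddGroup.of s + GrothendieckAddGroup.of (st s) := normHom_of
  set ι : face x →+ GrothendieckAddGroup (face x) := GrothendieckAddGroup.of with hι
  -- Applying `normHom` twice doubles it, so `n • normHom (normHom (a - b)) = 0` reads `(2 * n) •
  -- normHom (a - b) = 0`.
  obtain ⟨N, hN⟩ : ∃ N, 2 * n = N + 1 := ⟨2 * n - 1, by omega⟩
  have h1 : ι ((N + 1) • (a + st a)) = ι ((N + 1) • (b + st b)) := by
    rw [← hN, ← sub_eq_zero, map_nsmul, map_nsmul, map_add, map_add, ← hn0, mul_comm]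
    simp only [map_sub, map_add, hν, hst, mul_smul, two_nsmul, smul_add, smul_sub]
    abel
  obtain ⟨c, hc⟩ := of_eq_of_iff.1 h1
  have h2 : ι (⟨x, self_mem_face x⟩ + (b + st b)) = ι (⟨y, hy⟩ + (a + st a)) := by
    rw [map_sub, hν, hν] at hg
    simp only [map_add]
    rw [← sub_eq_zero]
    rw [← sub_eq_zero] at hg
    rw [← neg_eq_zero, ← hg]
    abel
  obtain ⟨c', hc'⟩ := of_eq_of_iff.1 h2
  have hcS := congrArg (Subtype.val : face x → S) hc
  have hcS' := congrArg (Subtype.val : face x → S) hc'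
  simp only [AddSubmonoid.coe_add, AddSubmonoidClass.coe_nsmul, st] at hcS hcS'
  have hK := kerVec_eq_of_nsmul_eq (φ := φ) hcS
  -- This `d` contains the summands needed to replace `x + (b + st b)` by `y + (a + st a)` and then
  -- `a + st a` by `b + st b`. It lies in the faces of both `x` and `y`, so it can be cancelled.
  set d : face x := b + st b + c' + (N • b + c) with hd
  have hdS : (d : S) = b + star (b : S) + c' + (N • (b : S) + c) := by
    simp [hd, st]
  obtain ⟨w, m, hw⟩ := d.2
  obtain ⟨w', m', hw'⟩ := hxy d.2
  refine kerVec_eq_of_mem_faces hw hw' ?_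
  have hK' := kerVec_add_congr hK ((y : S) + c')
  rw [hdS]
  calc φ.kerVec (x + (b + star (b : S) + c' + (N • (b : S) + c)))
      = φ.kerVec ((x + (b + star (b : S)) + c') + (N • (b : S) + c)) := by congr 1; abel
    _ = φ.kerVec ((a + star (a : S) + (N • (b : S) + c)) + (y + c')) := by
      rw [hcS']; congr 1; abel
    _ = φ.kerVec (y + (b + star (b : S) + c' + (N • (b : S) + c))) := by
      rw [hK']; congr 1; abel

/-! ### The shift by a hermitian involution -/

theorem Character.eq_one_or_eq_neg_one {u : S} (h2 : cls (2 • u) = 0) (σ : Character S) :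
    σ u = 1 ∨ σ u = -1 := by
  have h := (cls_eq_cls_iff _ _).1 (h2.trans cls_zero.symm) σ
  rw [two_nsmul, σ.map_add, σ.map_zero] at h
  exact mul_self_eq_one_iff.1 h

theorem cls_add_add {u : S} (h2 : cls (2 • u) = 0) (s : S) : cls (s + u + u) = cls s := by
  rw [add_assoc, ← two_nsmul, cls_add, h2, add_zero]

namespace PosDefFunction

variable {φ : PosDefFunction S}

theorem kerVec_eq_of_cls_eq {s t : S} (h : cls s = cls t) : φ.kerVec s = φ.kerVec t :=
  φ.kerVec_eq_of_forall_character_eq ((cls_eq_cls_iff s t).1 h)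

theorem apply_eq_of_cls_eq {s t : S} (h : cls s = cls t) (f : φ.Space) : f s = f t := by
  rw [← φ.inner_kerVec, ← φ.inner_kerVec, kerVec_eq_of_cls_eq h]

theorem mem_graph_shift_swap {u : S} (h2 : cls (2 • u) = 0) {p : φ.Space × φ.Space}
    (hp : p ∈ (φ.shift u).graph) : p.swap ∈ (φ.shift u).graph := by
  rw [graph_shift] at hp ⊢
  let D : φ.Space × φ.Space →L[ℂ] φ.Space × φ.Space :=
    (ContinuousLinearMap.snd ℂ _ _).prod (ContinuousLinearMap.fst ℂ _ _)
  have hD : ∀ q, D q = q.swap := fun _ => rfl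
  have hle : (φ.preShiftGraph u).topologicalClosure
      ≤ (φ.preShiftGraph u).topologicalClosure.comap D.toLinearMap := by
    refine Submodule.topologicalClosure_minimal _ (Submodule.span_le.2 ?_)
      ((Submodule.isClosed_topologicalClosure _).preimage D.continuous)
    rintro _ ⟨s, rfl⟩
    refine Submodule.mem_comap.2 (Submodule.le_topologicalClosure _
      (Submodule.subset_span ⟨s + u, ?_⟩))
    rw [ContinuousLinearMap.coe_coe, hD, Prod.swap_prod_mk]
    beta_reduce
    rw [kerVec_eq_of_cls_eq (cls_add_add h2 s)]
  rw [← hD]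
  exact Submodule.mem_comap.1 (hle hp)

/-- On generators this is `q.2 (s + u) = q.1 (s + u + star u) = q.1 s`, and it passes to the
closure. Thus `u_φ` is isometric. -/
theorem inner_snd_eq_inner_fst {u : S} (h2 : cls (2 • u) = 0) (hs : cls u = cls (star u))
    {p q : φ.Space × φ.Space} (hp : p ∈ (φ.shift u).graph) (hq : q ∈ (φ.shift u).graph) :
    inner ℂ q.2 p.2 = inner ℂ q.1 p.1 := by
  rw [graph_shift] at hp hq
  let L : φ.Space × φ.Space →L[ℂ] ℂ :=
    (innerSL ℂ q.2).comp (ContinuousLinearMap.snd ℂ _ _) -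
      (innerSL ℂ q.1).comp (ContinuousLinearMap.fst ℂ _ _)
  have hL : p ∈ L.ker := by
    refine Submodule.topologicalClosure_minimal _ (Submodule.span_le.2 ?_) L.isClosed_ker hp
    rintro _ ⟨s, rfl⟩
    change inner ℂ q.2 (φ.kerVec (s + u)) - inner ℂ q.1 (φ.kerVec s) = 0
    rw [sub_eq_zero, ← inner_conj_symm, ← inner_conj_symm q.1, inner_kerVec, inner_kerVec,
      φ.snd_apply_of_mem_closure u hq]
    congr 1
    refine apply_eq_of_cls_eq ?_ _
    rw [cls_add, ← hs, ← cls_add, cls_add_add h2]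
  exact sub_eq_zero.1 hL

/-- A closed isometric operator has closed domain, and this domain is also dense. -/
theorem domain_shift_eq_top {u : S} (h2 : cls (2 • u) = 0) (hs : cls u = cls (star u)) :
    (φ.shift u).domain = ⊤ := by
  let Γ := (φ.shift u).graph
  have hΓ : IsClosed (Γ : Set (φ.Space × φ.Space)) := by
    simp only [Γ, graph_shift]
    exact Submodule.isClosed_topologicalClosure _
  have : CompleteSpace Γ := hΓ.completeSpace_coe
  let P : Γ →L[ℂ] φ.Space := (ContinuousLinearMap.fst ℂ _ _).comp Γ.subtypeL
  have hP : AntilipschitzWith 1 P := by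
    refine P.antilipschitz_of_bound fun p => ?_
    have h1 : ‖(p : φ.Space × φ.Space).2‖ = ‖(p : φ.Space × φ.Space).1‖ := by
      have := inner_snd_eq_inner_fst h2 hs p.2 p.2
      rw [norm_eq_sqrt_re_inner (𝕜 := ℂ), norm_eq_sqrt_re_inner (𝕜 := ℂ), this]
    rw [NNReal.coe_one, one_mul]
    change max ‖(p : φ.Space × φ.Space).1‖ ‖(p : φ.Space × φ.Space).2‖
      ≤ ‖(p : φ.Space × φ.Space).1‖
    rw [h1, max_self]
  have hc : IsClosed (Set.range P) := hP.isClosed_range P.uniformContinuous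
  have hrange : Set.range P = (φ.shift u).domain := by
    ext x
    simp only [SetLike.mem_coe, LinearPMap.mem_domain_iff]
    constructor
    · rintro ⟨p, rfl⟩
      exact ⟨_, p.2⟩
    · rintro ⟨y, hy⟩
      exact ⟨⟨(x, y), hy⟩, rfl⟩
  rw [hrange] at hc
  refine SetLike.coe_injective ?_
  rw [← hc.closure_eq, (φ.dense_domain_shift u).closure_eq]
  rfl

theorem isPontryaginSymmetry_shift {u : S} (h2 : cls (2 • u) = 0) (hs : cls u = cls (star u))
    (hfin : FiniteDimensional ℂ (kerAddId (φ.shift u))) : IsPontryaginSymmetry (φ.shift u) where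
  adjoint_eq := by
    have hformal : (φ.shift u).IsFormalAdjoint (φ.shift u) := fun x y => by
      have hx := (φ.shift u).mem_graph x
      have hy := mem_graph_shift_swap h2 ((φ.shift u).mem_graph y)
      exact inner_snd_eq_inner_fst h2 hs hy hx
    have hle := hformal.le_adjoint (φ.dense_domain_shift u)
    refine (LinearPMap.eq_of_le_of_domain_eq hle (le_antisymm hle.1 ?_)).symm
    rw [domain_shift_eq_top h2 hs]
    exact le_top
  sq_eq_id x z := by
    constructor
    · rintro ⟨y, hxy, hyz⟩
      have h := mem_graph_shift_swap h2 hxy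
      exact LinearPMap.mem_graph_snd_inj _ hyz h rfl
    · rintro rfl
      have hz : z ∈ (φ.shift u).domain := by
        rw [domain_shift_eq_top h2 hs]
        trivial
      have := (φ.shift u).mem_graph ⟨z, hz⟩
      exact ⟨_, this, mem_graph_shift_swap h2 this⟩
  finite_ker := hfin

end PosDefFunction

/-! ### The dimension of `ker (u_φ + I)` -/

theorem two_mul_finrank_span_image_le {α V : Type*} [AddCommGroup V] [Module ℂ V]
    (M : Finset α) (ι : α → α) (hM : ∀ c ∈ M, ι c ∈ M) (hι : ∀ c ∈ M, ι (ι c) = c)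
    (hne : ∀ c ∈ M, ι c ≠ c) (w : α → V) (hw : ∀ c ∈ M, w (ι c) = -w c) :
    2 * Module.finrank ℂ (Submodule.span ℂ (w '' (M : Set α))) ≤ M.card := by
  classical
  -- An arbitrary linear order selects one element, the smaller, from each pair `{c, ι c}`.
  let _ : LinearOrder α := linearOrderOfSTO WellOrderingRel
  let T := M.filter fun c => c < ι c
  have hcard : 2 * T.card ≤ M.card := by
    have h1 : T.card ≤ (M.filter fun c => ¬ c < ι c).card := by
      refine Finset.card_le_card_of_injOn ι (fun c hc => ?_) fun c hc d hd h => ?_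
      · obtain ⟨hcM, hlt⟩ := Finset.mem_filter.1 hc
        refine Finset.mem_filter.2 ⟨hM c hcM, ?_⟩
        rw [hι c hcM]
        exact hlt.not_gt
      · rw [← hι c (Finset.mem_filter.1 hc).1, h, hι d (Finset.mem_filter.1 hd).1]
    have h2 := Finset.card_filter_add_card_filter_not (s := M) (fun c => c < ι c)
    have h3 : T.card = (M.filter fun c => c < ι c).card := rfl
    omega
  have hspan : Submodule.span ℂ (w '' (M : Set α))
      ≤ Submodule.span ℂ ((T.image w : Finset V) : Set V) := by
    rw [Submodule.span_le]
    rintro _ ⟨c, hc, rfl⟩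
    have hc : c ∈ M := hc
    rcases lt_or_gt_of_ne (hne c hc) with h | h
    · have hT : ι c ∈ T := Finset.mem_filter.2 ⟨hM c hc, by rwa [hι c hc]⟩
      rw [← neg_neg (w c), ← hw c hc]
      exact neg_mem (Submodule.subset_span (Finset.mem_coe.2 (Finset.mem_image_of_mem w hT)))
    · have hT : c ∈ T := Finset.mem_filter.2 ⟨hc, h⟩
      exact Submodule.subset_span (Finset.mem_coe.2 (Finset.mem_image_of_mem w hT))
  have hfin := Submodule.finrank_mono hspan
  have := (finrank_span_finset_le_card (R := ℂ) (T.image w)).trans Finset.card_image_le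
  simp only [Set.finrank] at this
  omega

theorem cls_surjective : Function.Surjective (cls : S → SepQuotient S) :=
  AddCon.mk'_surjective

theorem mem_kerAddId {H : Type*} [NormedAddCommGroup H] [InnerProductSpace ℂ H]
    {T : H →ₗ.[ℂ] H} {f : H} : f ∈ kerAddId T ↔ (f, -f) ∈ T.graph := Iff.rfl

/-- Finite dimensionality accompanies the bound because `finrank` is `0` on infinite-dimensional
spaces. -/
theorem finrank_kerAddId_shift_le {u : S} (h2 : cls (2 • u) = 0)
    (hM : (movedClasses u).Finite) (φ : PosDefFunction S) :
    FiniteDimensional ℂ (kerAddId (φ.shift u)) ∧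
      2 * Module.finrank ℂ (kerAddId (φ.shift u)) ≤ (movedClasses u).ncard := by
  let rep := Function.surjInv (cls_surjective (S := S))
  have hrep : ∀ c, cls (rep c) = c := Function.surjInv_eq cls_surjective
  let w : SepQuotient S → φ.Space := fun c => φ.kerVec (rep c) - φ.kerVec (rep c + u)
  have hw : ∀ s, w (cls s) = φ.kerVec s - φ.kerVec (s + u) := by
    intro s
    have h1 := hrep (cls s)
    have h3 : cls (rep (cls s) + u) = cls (s + u) := by rw [cls_add, h1, cls_add]
    simp only [w]
    rw [PosDefFunction.kerVec_eq_of_cls_eq h1, PosDefFunction.kerVec_eq_of_cls_eq h3]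
  let P := Submodule.span ℂ (w '' (hM.toFinset : Set (SepQuotient S)))
  have hPfin : FiniteDimensional ℂ P :=
    FiniteDimensional.span_of_finite ℂ (hM.toFinset.finite_toSet.image w)
  have hle : kerAddId (φ.shift u) ≤ P := by
    intro f hf
    rw [mem_kerAddId, PosDefFunction.graph_shift] at hf
    let D : φ.Space × φ.Space →L[ℂ] φ.Space :=
      ContinuousLinearMap.fst ℂ _ _ - ContinuousLinearMap.snd ℂ _ _
    -- The span `P` is finite-dimensional, hence closed, so membership of `K_s - K_{s+u}` passes to
    -- the closed graph. At `(f, -f)` the difference is `2f`.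
    have hD : (f, -f) ∈ P.comap D.toLinearMap := by
      refine Submodule.topologicalClosure_minimal _ (Submodule.span_le.2 ?_)
        (P.closed_of_finiteDimensional.preimage D.continuous) hf
      rintro _ ⟨s, rfl⟩
      change φ.kerVec s - φ.kerVec (s + u) ∈ P
      by_cases h : cls (u + s) = cls s
      · rw [add_comm s u, PosDefFunction.kerVec_eq_of_cls_eq h, sub_self]
        exact P.zero_mem
      · rw [← hw]
        exact Submodule.subset_span ⟨cls s, hM.mem_toFinset.2 ⟨s, rfl, h⟩, rfl⟩
    have hff : f - -f ∈ P := hD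
    rw [sub_neg_eq_add, ← two_smul ℂ] at hff
    exact (P.smul_mem_iff two_ne_zero).1 hff
  refine ⟨Submodule.finiteDimensional_of_le hle, ?_⟩
  refine (Nat.mul_le_mul_left 2 (Submodule.finrank_mono hle)).trans ?_
  rw [Set.ncard_eq_toFinset_card _ hM]
  refine two_mul_finrank_span_image_le hM.toFinset (fun c => c + cls u) ?_ ?_ ?_ w ?_
  · intro c hc
    obtain ⟨s, rfl, hs⟩ := hM.mem_toFinset.1 hc
    refine hM.mem_toFinset.2 ⟨s + u, rfl, fun h => hs ?_⟩
    rw [add_comm u, cls_add_add h2] at h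
    rw [add_comm, h]
  · intro c hc
    obtain ⟨s, rfl, hs⟩ := hM.mem_toFinset.1 hc
    exact cls_add_add h2 s
  · intro c hc
    obtain ⟨s, rfl, hs⟩ := hM.mem_toFinset.1 hc
    rw [add_comm]
    exact hs
  · intro c hc
    obtain ⟨s, rfl, hs⟩ := hM.mem_toFinset.1 hc
    rw [← cls_add, hw, hw, PosDefFunction.kerVec_eq_of_cls_eq (cls_add_add h2 s), neg_sub]

/-! ### The moved classes and the characters with `σ u = -1` -/

/-- The product of two characters. -/
def Character.mul (σ τ : Character S) : Character S where
  toFun s := σ s * τ s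
  map_add' s t := by rw [σ.map_add, τ.map_add, mul_mul_mul_comm]
  map_star' s := by rw [σ.map_star, τ.map_star, _root_.map_mul]
  exists_ne_zero' := ⟨0, by rw [σ.map_zero, τ.map_zero]; norm_num⟩

theorem Character.mul_apply (σ τ : Character S) (s : S) : σ.mul τ s = σ s * τ s := rfl

/-- The powers of a character. -/
def Character.npow (σ : Character S) (n : ℕ) : Character S where
  toFun s := σ s ^ n
  map_add' s t := by rw [σ.map_add, mul_pow]
  map_star' s := by rw [σ.map_star, _root_.map_pow]
  exists_ne_zero' := ⟨0, by rw [σ.map_zero, one_pow]; norm_num⟩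

theorem Character.npow_apply (σ : Character S) (n : ℕ) (s : S) : σ.npow n s = σ s ^ n := rfl

theorem exists_character_of_mem_movedClasses {u s : S} (h2 : cls (2 • u) = 0)
    (h : cls s ∈ movedClasses u) : ∃ σ : Character S, σ u = -1 ∧ σ s ≠ 0 := by
  obtain ⟨t, ht, hne⟩ := h
  have hs : cls (u + s) ≠ cls s := by rwa [cls_add, ← ht, ← cls_add]
  rw [Ne, cls_eq_cls_iff] at hs
  push Not at hs
  obtain ⟨σ, hσ⟩ := hs
  rw [σ.map_add] at hσ
  rcases σ.eq_one_or_eq_neg_one h2 with h1 | h1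
  · exact absurd (by rw [h1, one_mul]) hσ
  · refine ⟨σ, h1, fun h0 => hσ ?_⟩
    rw [h0, mul_zero]

/-- Odd powers of `σ` again take the value `-1` at `u`, so two of them coincide and every value of
`σ` is a root of a fixed nonzero polynomial. -/
theorem finite_range_character {u : S} (hX : {σ : Character S | σ u = -1}.Finite)
    {σ : Character S} (hσ : σ u = -1) : (Set.range σ).Finite := by
  have : Finite {σ : Character S | σ u = -1} := hX
  obtain ⟨k, l, hkl, h⟩ := Finite.exists_ne_map_eq_of_infinite
    (fun k : ℕ => (⟨σ.npow (2 * k + 1), by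
      rw [Set.mem_ofPred_eq, Character.npow_apply, hσ, Odd.neg_one_pow ⟨k, rfl⟩]⟩ :
        {σ : Character S | σ u = -1}))
  let p : Polynomial ℂ := Polynomial.X ^ (2 * k + 1) - Polynomial.X ^ (2 * l + 1)
  have hp : p ≠ 0 := by
    rw [sub_ne_zero]
    intro heq
    have := congrArg Polynomial.natDegree heq
    rw [Polynomial.natDegree_X_pow, Polynomial.natDegree_X_pow] at this
    omega
  refine (Polynomial.finite_setOfPred_isRoot hp).subset ?_
  rintro _ ⟨s, rfl⟩
  have hs : σ s ^ (2 * k + 1) = σ s ^ (2 * l + 1) :=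
    DFunLike.congr_fun (congrArg Subtype.val h) s
  change Polynomial.eval (σ s) p = 0
  simp [p, hs]

theorem finite_movedClasses {u : S} (h2 : cls (2 • u) = 0)
    (hX : {σ : Character S | σ u = -1}.Finite) : (movedClasses u).Finite := by
  let rep := Function.surjInv (cls_surjective (S := S))
  have hrep : ∀ c, cls (rep c) = c := Function.surjInv_eq cls_surjective
  have : Finite {σ : Character S | σ u = -1} := hX
  let v : SepQuotient S → {σ : Character S | σ u = -1} → ℂ := fun c σ => σ.1 (rep c)
  refine Set.Finite.of_finite_image (f := v) ?_ ?_
  · refine (Set.Finite.pi' fun σ : {σ : Character S | σ u = -1} =>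
      finite_range_character hX σ.2).subset ?_
    rintro _ ⟨c, -, rfl⟩ σ
    exact ⟨rep c, rfl⟩
  · intro c hc d hd hcd
    rw [← hrep c] at hc
    obtain ⟨σ, hσ, hσ0⟩ := exists_character_of_mem_movedClasses h2 hc
    have key : ∀ ρ : Character S, ρ u = -1 → ρ (rep c) = ρ (rep d) :=
      fun ρ hρ => congrFun hcd ⟨ρ, hρ⟩
    rw [← hrep c, ← hrep d, cls_eq_cls_iff]
    intro ρ
    rcases ρ.eq_one_or_eq_neg_one h2 with h1 | h1
    -- When `ρ u = 1`, the product `ρσ` is `-1` at `u`. Cancelling `σ (rep c) ≠ 0` recovers the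
    -- value of `ρ`.
    · have := key (ρ.mul σ) (by rw [Character.mul_apply, h1, hσ, one_mul])
      rw [Character.mul_apply, Character.mul_apply, ← key σ hσ] at this
      exact mul_right_cancel₀ hσ0 this
    · exact key ρ h1

/-! ### Sequences of characters -/

/-- The character `s ↦ σ s * ‖σ s‖ ^ (t - 1)`. -/
def Character.normRpow (σ : Character S) (t : ℝ) : Character S where
  toFun s := σ s * ((‖σ s‖ ^ (t - 1) : ℝ) : ℂ)
  map_add' s r := by
    rw [σ.map_add, norm_mul, Real.mul_rpow (norm_nonneg _) (norm_nonneg _), Complex.ofReal_mul,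
      mul_mul_mul_comm]
  map_star' s := by rw [σ.map_star, _root_.map_mul, Complex.conj_ofReal, RCLike.norm_conj]
  exists_ne_zero' := ⟨0, by rw [σ.map_zero]; norm_num⟩

theorem Character.normRpow_apply (σ : Character S) (t : ℝ) (s : S) :
    σ.normRpow t s = σ s * ((‖σ s‖ ^ (t - 1) : ℝ) : ℂ) := rfl

theorem Character.norm_normRpow (σ : Character S) {t : ℝ} (ht : t ≠ 0) (s : S) :
    ‖σ.normRpow t s‖ = ‖σ s‖ ^ t := by
  rw [σ.normRpow_apply, norm_mul, Complex.norm_real,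
    Real.norm_of_nonneg (Real.rpow_nonneg (norm_nonneg _) _)]
  rcases eq_or_ne ‖σ s‖ 0 with h | h
  · rw [h, zero_mul, Real.zero_rpow ht]
  · have hpos : 0 < ‖σ s‖ := lt_of_le_of_ne (norm_nonneg _) h.symm
    rw [Real.rpow_sub_one h]
    field_simp

/-- Infinitely many characters with `σ u = -1` yield a pointwise bounded sequence of them. -/
theorem exists_bounded_sequence {u : S} (hX : {σ : Character S | σ u = -1}.Infinite) :
    ∃ τ : ℕ → Character S, Function.Injective τ ∧ (∀ n, τ n u = -1) ∧
      ∀ s, ∃ C, ∀ n, ‖τ n s‖ ≤ C := by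
  -- If some such `σ` is unbounded by `1`, shrinking its modulus to the power `1 / (n + 1)` gives
  -- distinct characters bounded by `max 1 ‖σ r‖`. Otherwise any injective sequence is bounded by
  -- `1`.
  by_cases h : ∃ (σ : Character S) (s : S), σ u = -1 ∧ 1 < ‖σ s‖
  · obtain ⟨σ, s, hσ, hs⟩ := h
    have ht : ∀ n : ℕ, (0 : ℝ) < 1 / (n + 1) := fun n => by positivity
    refine ⟨fun n => σ.normRpow (1 / (n + 1)), ?_, ?_, ?_⟩
    · intro n m hnm
      have := congrArg norm (DFunLike.congr_fun hnm s)
      rw [σ.norm_normRpow (ht n).ne', σ.norm_normRpow (ht m).ne'] at this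
      have h1 := (Real.strictMono_rpow_of_base_gt_one hs).injective this
      field_simp at h1
      exact_mod_cast (add_right_cancel h1).symm
    · intro n
      simp [Character.normRpow_apply, hσ]
    · intro r
      refine ⟨max 1 ‖σ r‖, fun n => ?_⟩
      rw [σ.norm_normRpow (ht n).ne']
      rcases le_total ‖σ r‖ 1 with h1 | h1
      · exact (Real.rpow_le_one (norm_nonneg _) h1 (ht n).le).trans (le_max_left _ _)
      · refine le_trans ?_ (le_max_right _ _)
        conv_rhs => rw [← Real.rpow_one ‖σ r‖]
        refine Real.rpow_le_rpow_of_exponent_le h1 ?_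
        rw [div_le_one (by positivity)]
        linarith [Nat.cast_nonneg (α := ℝ) n]
  · push Not at h
    refine ⟨fun n => hX.natEmbedding _ n, fun n m hnm => ?_, fun n => (hX.natEmbedding _ n).2,
      fun s => ⟨1, fun n => h _ s (hX.natEmbedding _ n).2⟩⟩
    exact (hX.natEmbedding _).injective (Subtype.ext hnm)

/-! ### Moment functions of sequences of characters -/

theorem measurable_eval (s : S) : Measurable fun σ : Character S => σ s := by
  rw [measurable_iff_comap_le, BorelSpace.measurable_eq (α := ℂ)]
  exact le_iSup (fun s : S => MeasurableSpace.comap (fun σ : Character S => σ s) (borel ℂ)) s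

theorem isMomentFunction_of_bounded (ν : Measure ℕ) [IsFiniteMeasure ν] {τ : ℕ → Character S}
    (hτ : ∀ s, ∃ C, ∀ n, ‖τ n s‖ ≤ C) : IsMomentFunction fun s => ∫ n, τ n s ∂ν := by
  have hm : AEMeasurable τ ν := (measurable_from_top (f := τ)).aemeasurable
  refine ⟨ν.map τ, fun s => ?_, fun s => ?_⟩
  · rw [memLp_map_measure_iff (measurable_eval s).aestronglyMeasurable hm]
    obtain ⟨C, hC⟩ := hτ s
    exact MemLp.of_bound (measurable_from_top).aestronglyMeasurable C (ae_of_all _ hC)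
  · rw [integral_map hm (measurable_eval s).aestronglyMeasurable]

theorem isMomentFunction_character (σ : Character S) : IsMomentFunction σ := by
  have h := isMomentFunction_of_bounded (Measure.dirac 0) (τ := fun _ => σ)
    fun s => ⟨‖σ s‖, fun _ => le_rfl⟩
  simpa using h

/-- Each character is its own moment function. For `φ = σ`, applying `u_φ² = I` and the symmetry of
`u_φ` to `K_0` gives `σ (2 • u) = 1` and `σ u = σ (star u)`. -/
theorem cls_eq_of_isPontryaginSymmetry {u : S}
    (h : ∀ (φ : S → ℂ) (hφ : IsMomentFunction φ),
      IsPontryaginSymmetry (PosDefFunction.shift ⟨φ, hφ.isPositiveDefinite⟩ u)) :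
    cls (2 • u) = 0 ∧ cls u = cls (star u) := by
  have hgraph : ∀ (φ : PosDefFunction S) (s : S),
      (φ.kerVec s, φ.kerVec (s + u)) ∈ (φ.shift u).graph := fun φ s => by
    rw [PosDefFunction.graph_shift]
    exact Submodule.le_topologicalClosure _ (Submodule.subset_span ⟨s, rfl⟩)
  constructor
  · rw [← cls_zero, cls_eq_cls_iff]
    intro σ
    let φ : PosDefFunction S := ⟨σ, (isMomentFunction_character σ).isPositiveDefinite⟩
    have hφ : IsPontryaginSymmetry (φ.shift u) := h σ (isMomentFunction_character σ)
    have h1 := (hφ.sq_eq_id _ _).1 ⟨_, hgraph φ 0, hgraph φ (0 + u)⟩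
    have h2 := PosDefFunction.kerVec_eq_iff.1 h1 0
    rw [zero_add, ← two_nsmul, add_zero, add_zero] at h2
    exact h2
  · rw [cls_eq_cls_iff]
    intro σ
    let φ : PosDefFunction S := ⟨σ, (isMomentFunction_character σ).isPositiveDefinite⟩
    have hφ : IsPontryaginSymmetry (φ.shift u) := h σ (isMomentFunction_character σ)
    have hadj := LinearPMap.adjoint_isFormalAdjoint (φ.dense_domain_shift u)
    rw [hφ.adjoint_eq] at hadj
    obtain ⟨x, hx0, hxu⟩ := (LinearPMap.mem_graph_iff _).1 (hgraph φ 0)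
    have h1 := hadj x x
    rw [hxu, hx0] at h1
    simp only [PosDefFunction.inner_kerVec_kerVec] at h1
    have h2 : σ (star 0 + (0 + u)) = σ (star (0 + u) + 0) := h1
    simpa using h2

/-! ### Infinite-dimensional eigenspaces from sequences of characters -/

/-- The functional `∑ c s • s ↦ ∑ c s * conj (σ s)` of a character `σ`. -/
def conjFunctional (σ : Character S) : (S →₀ ℂ) →ₗ[ℂ] ℂ :=
  Finsupp.linearCombination ℂ fun s => conj (σ s)

theorem conjFunctional_apply (σ : Character S) (c : S →₀ ℂ) :
    conjFunctional σ c = ∑ s ∈ c.support, c s * conj (σ s) := by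
  simp [conjFunctional, Finsupp.linearCombination_apply, Finsupp.sum]

theorem linearIndependent_conjFunctional {ι : Type*} {τ : ι → Character S}
    (hτ : Function.Injective τ) : LinearIndependent ℂ fun n => conjFunctional (τ n) := by
  -- Evaluation on the basis turns the functionals into distinct monoid homomorphisms, which are
  -- independent by Dedekind's theorem.
  let E : ((S →₀ ℂ) →ₗ[ℂ] ℂ) →ₗ[ℂ] (Multiplicative S → ℂ) :=
    LinearMap.pi fun s => LinearMap.applyₗ (Finsupp.single s.toAdd 1)
  let m : ι → Multiplicative S →* ℂ := fun n =>
    { toFun := fun s => conj (τ n s.toAdd)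
      map_one' := by rw [toAdd_one, (τ n).map_zero, _root_.map_one]
      map_mul' := fun s t => by rw [toAdd_mul, (τ n).map_add, _root_.map_mul] }
  have hm : Function.Injective m := fun n k h => hτ (DFunLike.ext _ _ fun s =>
    (starRingEnd ℂ).injective (DFunLike.congr_fun h (Multiplicative.ofAdd s)))
  refine LinearIndependent.of_comp E ?_
  convert! (linearIndependent_monoidHom (Multiplicative S) ℂ).comp m hm using 1
  funext n s
  simp [E, m, conjFunctional]

variable {τ : ℕ → Character S}

/-- A moment function of a measure of full support on a sequence of characters. -/
def sequencePosDef (hτ : ∀ s, ∃ C, ∀ n, ‖τ n s‖ ≤ C) : PosDefFunction S :=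
  ⟨fun s => ∫ n, τ n s ∂(Measure.count : Measure ℕ).toFinite,
    (isMomentFunction_of_bounded _ hτ).isPositiveDefinite⟩

theorem integrable_sequence (hτ : ∀ s, ∃ C, ∀ n, ‖τ n s‖ ≤ C) (s : S) :
    Integrable (fun n => τ n s) (Measure.count : Measure ℕ).toFinite := by
  obtain ⟨C, hC⟩ := hτ s
  exact Integrable.of_bound measurable_from_top.aestronglyMeasurable C (ae_of_all _ hC)

/-- The squared norm of `∑ c s • K_s` is the integral over `n` of `‖conjFunctional (τ n) c‖ ^ 2`. -/
theorem conjFunctional_eq_zero (hτ : ∀ s, ∃ C, ∀ n, ‖τ n s‖ ≤ C) (c : S →₀ ℂ)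
    (hc : Finsupp.linearCombination ℂ (sequencePosDef hτ).kerVec c = 0) (n : ℕ) :
    conjFunctional (τ n) c = 0 := by
  set ν := (Measure.count : Measure ℕ).toFinite with hν
  have happly : ∀ t, (sequencePosDef hτ).toFun t = ∫ n, τ n t ∂ν := fun _ => rfl
  have h1 : ∀ t, ∑ s ∈ c.support, c s * (sequencePosDef hτ).toFun (star s + t) = 0 := by
    intro t
    have := congrArg (fun f => inner ℂ ((sequencePosDef hτ).kerVec t) f) hc
    simp only [Finsupp.linearCombination_apply, Finsupp.sum, inner_sum, inner_smul_right,
      PosDefFunction.inner_kerVec_kerVec, inner_zero_right] at this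
    exact this
  have hint : ∀ s t, Integrable (fun n => conj (c t) * (c s * τ n (star s + t))) ν :=
    fun s t => ((integrable_sequence hτ (star s + t)).const_mul _).const_mul _
  have hsq : ∀ n, ((‖conjFunctional (τ n) c‖ ^ 2 : ℝ) : ℂ) =
      ∑ t ∈ c.support, ∑ s ∈ c.support, conj (c t) * (c s * τ n (star s + t)) := by
    intro n
    rw [Complex.ofReal_pow, ← Complex.conj_mul', conjFunctional_apply, map_sum,
      Finset.sum_mul_sum]
    refine Finset.sum_congr rfl fun t _ => Finset.sum_congr rfl fun s _ => ?_
    rw [map_mul, Complex.conj_conj, (τ n).map_add, (τ n).map_star]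
    ring
  have hint' : Integrable (fun n => ((‖conjFunctional (τ n) c‖ ^ 2 : ℝ) : ℂ)) ν := by
    simp only [hsq]
    exact integrable_finsetSum _ fun t _ => integrable_finsetSum _ fun s _ => hint s t
  have h0 : ∫ n, ((‖conjFunctional (τ n) c‖ ^ 2 : ℝ) : ℂ) ∂ν = 0 := by
    simp only [hsq]
    rw [integral_finsetSum _ fun t _ => integrable_finsetSum _ fun s _ => hint s t]
    refine Finset.sum_eq_zero fun t _ => ?_
    rw [integral_finsetSum _ fun s _ => hint s t]
    simp only [integral_const_mul, ← happly]
    rw [← Finset.mul_sum, h1, mul_zero]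
  rw [integral_complex_ofReal, Complex.ofReal_eq_zero,
    integral_eq_zero_iff_of_nonneg (fun n => by positivity) (by simpa using hint'.norm)]
    at h0
  -- Counting measure is absolutely continuous with respect to its finite version, so almost
  -- everywhere means at every `n`.
  have hae := Filter.EventuallyEq.filter_mono h0 (absolutelyContinuous_toFinite _).ae_le
  have hall : ∀ n, ‖conjFunctional (τ n) c‖ ^ 2 = 0 := by
    simpa [Filter.EventuallyEq, Measure.ae_count_iff] using hae
  simpa using hall n

theorem kerVec_mem_kerAddId (hτ : ∀ s, ∃ C, ∀ n, ‖τ n s‖ ≤ C) {u : S}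
    (hu : ∀ n, τ n u = -1) (s : S) :
    (sequencePosDef hτ).kerVec s ∈ kerAddId ((sequencePosDef hτ).shift u) := by
  have hneg : (sequencePosDef hτ).kerVec (s + u) = -(sequencePosDef hτ).kerVec s := by
    refine RKHS.ext fun t => ?_
    rw [RKHS.coe_neg, Pi.neg_apply, PosDefFunction.kerVec_apply, PosDefFunction.kerVec_apply]
    change ∫ n, τ n _ ∂_ = -∫ n, τ n _ ∂_
    rw [← integral_neg]
    congr 1
    funext n
    simp [(τ n).map_add, (τ n).map_star, hu]
  rw [mem_kerAddId, PosDefFunction.graph_shift, ← hneg]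
  exact Submodule.le_topologicalClosure _ (Submodule.subset_span ⟨s, rfl⟩)

theorem not_finiteDimensional_kerAddId (hτ : ∀ s, ∃ C, ∀ n, ‖τ n s‖ ≤ C)
    {u : S} (hinj : Function.Injective τ)
    (hu : ∀ n, τ n u = -1) :
    ¬ FiniteDimensional ℂ (kerAddId ((sequencePosDef hτ).shift u)) := by
  intro hfin
  let L : (S →₀ ℂ) →ₗ[ℂ] kerAddId ((sequencePosDef hτ).shift u) :=
    Finsupp.linearCombination ℂ fun s => ⟨_, kerVec_mem_kerAddId hτ hu s⟩
  have hL : ∀ c, (L c : (sequencePosDef hτ).Space)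
      = Finsupp.linearCombination ℂ (sequencePosDef hτ).kerVec c := fun c => by
    simp [L, Finsupp.linearCombination_apply, Finsupp.sum]
  -- Each functional vanishes on `ker L`, so it factors through `L`. This puts infinitely many
  -- independent functionals in the dual of a finite-dimensional space.
  have hmem : ∀ n, conjFunctional (τ n) ∈ L.dualMap.range := fun n => by
    rw [LinearMap.range_dualMap_eq_dualAnnihilator_ker, Submodule.mem_dualAnnihilator]
    intro c hc
    refine conjFunctional_eq_zero hτ c ?_ n
    rw [← hL, LinearMap.mem_ker.1 hc, Submodule.coe_zero]
  choose m hm using hmem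
  have hind : LinearIndependent ℂ m := LinearIndependent.of_comp L.dualMap <| by
    convert! linearIndependent_conjFunctional hinj using 1
    exact funext hm
  have := hind.finite_of_isNoetherian
  exact not_finite ℕ

theorem finite_setOf_character_eq_neg_one {u : S}
    (h : ∀ (φ : S → ℂ) (hφ : IsMomentFunction φ),
      FiniteDimensional ℂ (kerAddId (PosDefFunction.shift ⟨φ, hφ.isPositiveDefinite⟩ u))) :
    {σ : Character S | σ u = -1}.Finite := by
  by_contra hX
  obtain ⟨τ, hinj, hu, hτ⟩ := exists_bounded_sequence hX
  exact not_finiteDimensional_kerAddId hτ hinj hu (h _ (isMomentFunction_of_bounded _ hτ))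

end StarSemigroup

end

theorem theorem6 {S : Type*} [AddCommMonoid S] [StarAddMonoid S] (u : S) :
    (StarSemigroup.cls (2 • u) = 0 → StarSemigroup.cls u = StarSemigroup.cls (star u) →
      List.TFAE [
        (StarSemigroup.movedClasses u).Finite,
        {σ : StarSemigroup.Character S | σ u = -1}.Finite,
        ∀ (φ : S → ℂ) (hφ : StarSemigroup.IsMomentFunction φ),
          FiniteDimensional ℂ (StarSemigroup.kerAddId
            (StarSemigroup.PosDefFunction.shift ⟨φ, hφ.isPositiveDefinite⟩ u)),
        ∀ φ : StarSemigroup.PosDefFunction S,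
          FiniteDimensional ℂ (StarSemigroup.kerAddId (φ.shift u))] ∧
      ((StarSemigroup.movedClasses u).Finite →
        ∀ φ : StarSemigroup.PosDefFunction S,
          FiniteDimensional ℂ (StarSemigroup.kerAddId (φ.shift u)) ∧
          2 * Module.finrank ℂ (StarSemigroup.kerAddId (φ.shift u)) ≤
            (StarSemigroup.movedClasses u).ncard)) ∧
    List.TFAE [
      ∀ φ : StarSemigroup.PosDefFunction S, StarSemigroup.IsPontryaginSymmetry (φ.shift u),
      ∀ (φ : S → ℂ) (hφ : StarSemigroup.IsMomentFunction φ),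
        StarSemigroup.IsPontryaginSymmetry
          (StarSemigroup.PosDefFunction.shift ⟨φ, hφ.isPositiveDefinite⟩ u),
      StarSemigroup.cls (2 • u) = 0 ∧ StarSemigroup.cls u = StarSemigroup.cls (star u) ∧
        (StarSemigroup.movedClasses u).Finite] := by
  have hbound := fun (h2 : StarSemigroup.cls (2 • u) = 0)
      (hM : (StarSemigroup.movedClasses u).Finite) (φ : StarSemigroup.PosDefFunction S) =>
    StarSemigroup.finrank_kerAddId_shift_le h2 hM φ
  constructor
  · intro h2 _
    refine ⟨?_, hbound h2⟩
    tfae_have 1 → 4 := fun hM φ => (hbound h2 hM φ).1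
    tfae_have 4 → 3 := fun h φ hφ => h ⟨φ, hφ.isPositiveDefinite⟩
    tfae_have 3 → 2 := StarSemigroup.finite_setOf_character_eq_neg_one
    tfae_have 2 → 1 := StarSemigroup.finite_movedClasses h2
    tfae_finish
  · tfae_have 1 → 2 := fun h φ hφ => h ⟨φ, hφ.isPositiveDefinite⟩
    tfae_have 2 → 3 := fun h => by
      obtain ⟨h2, hs⟩ := StarSemigroup.cls_eq_of_isPontryaginSymmetry h
      exact ⟨h2, hs, StarSemigroup.finite_movedClasses h2
        (StarSemigroup.finite_setOf_character_eq_neg_one fun φ hφ => (h φ hφ).finite_ker)⟩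
    tfae_have 3 → 1 := fun ⟨h2, hs, hM⟩ φ =>
      StarSemigroup.PosDefFunction.isPontryaginSymmetry_shift h2 hs (hbound h2 hM φ).1
    tfae_finish
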